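/- Let $Y$ be a finite-dimensional Euclidean space, $K\subseteq Y$ a (nonempty) closed convex cone with dual cone $K^*=\{y:\langle y,x\rangle\ge 0\ \forall x\in K\}$, let $a_1,\dots,a_m,b\in Y$ and $c\in\mathbb R^m$, and put $Ax=\sum_{i=1}^m x_ia_i$, $A^*y=(\langle a_1,y\rangle,\dots,\langle a_m,y\rangle)^T$. Consider the conic linear systems $$(P)\quad b-Ax\in K,\qquad\qquad (D)\quad A^*y=c,\ y\in K^* .$$ $(P)$ is called strongly infeasible if there is $y\in K^*$ with $A^*y=0$, $\langle b,y\rangle=-1$; $(D)$ is called strongly infeasible if there is $x\in\mathbb R^m$ with $Ax\in K$, $\langle c,x\rangle=-1$. A reformulation of the data $(a,b,c)$ is any $(a',b',c')$ obtained from it by finitely many elementary row operations: replace $(a_i,c_i)$ by $(A\lambda,\langle c,\lambda\rangle)$ for some $i$ and some $\lambda\in\mathbb R^m$ with $\lambda_i\neq0$; switch $(a_i,c_i)$ and $(a_j,c_j)$ with $i\ne j$; replace $b$ by $b+A\mu$ for some $\mu\in\mathbb R^m$. For a closed convex cone $C\subseteq Y$ and $k\ge1$ let $\operatorname{FR}_k(C)$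 be the set of all $(y_1,\dots,y_k)\in Y^k$ with $y_i\in(C\cap y_1^\perp\cap\dots\cap y_{i-1}^\perp)^*$ for $i=1,\dots,k$. Such a sequence is strict if moreover $y_i\notin(C\cap y_1^\perp\cap\dots\cap y_{i-1}^\perp)^\perp$ for $i=1,\dots,k$, and pre-strict if $(y_1,\dots,y_{k-1})$ is strict (no condition if $k=1$). A face of $C$ is a convex $F\subseteq C$ such that $y,z\in C$ and $\frac12(y+z)\in F$ imply $y,z\in F$; let $\ell_C$ be the largest $k$ for which there are nonempty faces $F_1\subsetneq F_2\subsetneq\dots\subsetneq F_k$ of $C$. Then the following hold. 1. $(D)$ is infeasible if and only if there are a reformulation $(a',b',c')$ and an integer $k$ with $0\le k\le\ell_{K^*}-1$ and $k+1\le m$ such that $(a_1',\dots,a_{k+1}')\in\operatorname{FR}_{k+1}(K^*)$, $c_i'=0$ for $i=1,\dots,k$, and $c_{k+1}'=-1$. 2. $(D)$ is not strongly infeasible if and only if there are an integer $\ell$ with $0\le\ell\le\ell_K-1$ and $(y_1,\dots,y_{\ell+1})\in\operatorname{FR}_{\ell+1}(K)$ such that $A^*y_i=0$ for $i=1,\dots,\ell$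 and $A^*y_{\ell+1}=c$. 3. $(P)$ is infeasible if and only if there are an integer $k$ with $0\le k\le\ell_K-1$ and $(y_1,\dots,y_{k+1})\in\operatorname{FR}_{k+1}(K)$ such that $A^*y_i=0$, $\langle b,y_i\rangle=0$ for $i=1,\dots,k$, and $A^*y_{k+1}=0$, $\langle b,y_{k+1}\rangle=-1$. 4. $(P)$ is not strongly infeasible if and only if there are a reformulation $(a',b',c')$ and an integer $\ell$ with $0\le\ell\le\min\{m,\ell_{K^*}-1\}$ such that $(a_1',\dots,a_\ell',b')\in\operatorname{FR}_{\ell+1}(K^*)$. In all four parts, whenever the left-hand side of the equivalence holds, the facial reduction sequence on the right-hand side can be chosen pre-strict (with the same bounds on its length). -/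

import Mathlib

open scoped RealInnerProductSpace

namespace ConicLP

section Cones

variable {Y : Type*} [NormedAddCommGroup Y] [InnerProductSpace ℝ Y]

/-- `F` is a face of `K`: a convex subset of `K` such that `y, z ∈ K` and `(y + z) / 2 ∈ F`
imply `y, z ∈ F`. -/
def IsFace (K F : Set Y) : Prop :=
  F ⊆ K ∧ Convex ℝ F ∧
    ∀ y ∈ K, ∀ z ∈ K, (1 / 2 : ℝ) • (y + z) ∈ F → y ∈ F ∧ z ∈ F

/-- The lengths `k` of the strictly increasing chains `F 0 ⊊ F 1 ⊊ ⋯ ⊊ F (k - 1)` of nonempty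
faces of `K`. -/
def faceChainLengths (K : Set Y) : Set ℕ :=
  {k | ∃ F : Fin k → Set Y, (∀ i, IsFace K (F i) ∧ (F i).Nonempty) ∧ StrictMono F}

/-- `ℓ_K`, the length of the longest chain of nonempty faces of `K`.  For a closed convex cone in
a finite dimensional space it is a maximum, see `isGreatest_maxFaceChain`. -/
noncomputable def maxFaceChain (K : Set Y) : ℕ := sSup (faceChainLengths K)

variable [FiniteDimensional ℝ Y]

/-- `C^{*∖⊥} = C^* ∖ C^⊥`, where `C^⊥` is the orthogonal complement of the linear span of `C`. -/
def dualMinusPerp (C : Set Y) : Set Y :=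
  {y | y ∈ ProperCone.innerDual C ∧ y ∉ (Submodule.span ℝ C)ᗮ}

/-- `K ∩ y_1^⊥ ∩ ⋯ ∩ y_{i-1}^⊥`, for the sequence `y` and the index `i`. -/
def cutBefore (K : Set Y) {k : ℕ} (y : Fin k → Y) (i : Fin k) : Set Y :=
  {x | x ∈ K ∧ ∀ j < i, ⟪y j, x⟫ = 0}

/-- The order `k` facial reduction cone `FR_k(K)`: the sequences `(y_1, …, y_k)` such that
`y_i ∈ (K ∩ y_1^⊥ ∩ ⋯ ∩ y_{i-1}^⊥)^*` for all `i` (in particular `y_1 ∈ K^*`). -/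
def FR (K : Set Y) (k : ℕ) : Set (Fin k → Y) :=
  {y | ∀ i, y i ∈ ProperCone.innerDual (cutBefore K y i)}

/-- A strict sequence: `y_i ∈ (K ∩ y_1^⊥ ∩ ⋯ ∩ y_{i-1}^⊥)^{*∖⊥}` for all `i`. -/
def IsStrict (K : Set Y) {k : ℕ} (y : Fin k → Y) : Prop :=
  ∀ i, y i ∈ dualMinusPerp (cutBefore K y i)

/-- `(y_1, …, y_{k+1})` is pre-strict if it is in `FR_{k+1}(K)` and `(y_1, …, y_k)` is strict. -/
def IsPreStrict (K : Set Y) {k : ℕ} (y : Fin (k + 1) → Y) : Prop :=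
  y ∈ FR K (k + 1) ∧ IsStrict K (Fin.init y)

end Cones

section Systems

variable {Y : Type*} [NormedAddCommGroup Y] [InnerProductSpace ℝ Y] {m : ℕ}

/-- The data of the pair of conic linear programs
(P) `sup ⟨c, x⟩` s.t. `A x ≤_K b`, and (D) `inf ⟨b, y⟩` s.t. `A^* y = c, y ∈ K^*`;
the linear map `A : ℝ^m → Y` is given by the images `a i` of the unit vectors. -/
structure Data (m : ℕ) (Y : Type*) where
  a : Fin m → Y
  b : Y
  c : Fin m → ℝ

/-- `A x = ∑ x_i a_i`. -/
def Data.A (d : Data m Y) (x : Fin m → ℝ) : Y := ∑ i, x i • d.a i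

/-- `A^* y = (⟨a_1, y⟩, …, ⟨a_m, y⟩)`. -/
def Data.Astar (d : Data m Y) (y : Y) : Fin m → ℝ := fun i => ⟪d.a i, y⟫

/-- One elementary row operation. -/
inductive RowOp : Data m Y → Data m Y → Prop
  /-- Replace `(a_i, c_i)` by `(A λ, ⟨c, λ⟩)`, where `λ_i ≠ 0`. -/
  | replace (d : Data m Y) (i : Fin m) (l : Fin m → ℝ) (hl : l i ≠ 0) :
      RowOp d ⟨Function.update d.a i (d.A l), d.b, Function.update d.c i (∑ j, d.c j * l j)⟩
  /-- Switch `(a_i, c_i)` and `(a_j, c_j)`. -/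
  | switch (d : Data m Y) (i j : Fin m) (hij : i ≠ j) :
      RowOp d ⟨d.a ∘ Equiv.swap i j, d.b, d.c ∘ Equiv.swap i j⟩
  /-- Replace `b` by `b + A μ`. -/
  | shift (d : Data m Y) (μ : Fin m → ℝ) :
      RowOp d ⟨d.a, d.b + d.A μ, d.c⟩

/-- `d'` is a reformulation of `d`: it arises by finitely many elementary row operations. -/
def IsReformulation (d d' : Data m Y) : Prop := Relation.ReflTransGen RowOp d d'

variable [FiniteDimensional ℝ Y]

/-- (P) is feasible: `b - A x ∈ K` for some `x`. -/
def PFeasible (K : ProperCone ℝ Y) (d : Data m Y) : Prop :=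
  ∃ x : Fin m → ℝ, d.b - d.A x ∈ K

/-- (D) is feasible: `A^* y = c` for some `y ∈ K^*`. -/
def DFeasible (K : ProperCone ℝ Y) (d : Data m Y) : Prop :=
  ∃ y ∈ ProperCone.innerDual (K : Set Y), d.Astar y = d.c

/-- (P) is strongly infeasible: the system `A^* y = 0, ⟨b, y⟩ = -1, y ∈ K^*` is feasible. -/
def PStronglyInfeasible (K : ProperCone ℝ Y) (d : Data m Y) : Prop :=
  ∃ y ∈ ProperCone.innerDual (K : Set Y), d.Astar y = 0 ∧ ⟪d.b, y⟫ = -1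

/-- (D) is strongly infeasible: the system `A x ∈ K, ⟨c, x⟩ = -1` is feasible. -/
def DStronglyInfeasible (K : ProperCone ℝ Y) (d : Data m Y) : Prop :=
  ∃ x : Fin m → ℝ, d.A x ∈ K ∧ ∑ i, d.c i * x i = -1

end Systems

section FaceChains

variable {Y : Type*} [NormedAddCommGroup Y] [InnerProductSpace ℝ Y]

/-- A nonempty face of a cone contains every point of the cone that lies in its span. -/
theorem IsFace.mem_of_mem_span {K : ProperCone ℝ Y} {F : Set Y} (hF : IsFace (K : Set Y) F)
    (hne : F.Nonempty) {g : Y} (hgK : g ∈ K) (hg : g ∈ Submodule.span ℝ F) : g ∈ F := by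
  obtain ⟨hsub, hconv, hface⟩ := hF
  have hsm : ∀ (t : ℝ), 0 ≤ t → ∀ x ∈ K, t • x ∈ K := fun t ht x hx => K.smul_mem hx ht
  have h2 : ∀ x ∈ F, (0 : Y) ∈ F ∧ (2 : ℝ) • x ∈ F := by
    intro x hx
    refine hface 0 (zero_mem K) _ (hsm 2 (by norm_num) x (hsub hx)) ?_
    rw [zero_add, smul_smul]
    norm_num
    exact hx
  have h0 : (0 : Y) ∈ F := by
    obtain ⟨x, hx⟩ := hne
    exact (h2 x hx).1
  have hadd : ∀ x ∈ F, ∀ y ∈ F, x + y ∈ F := by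
    intro x hx y hy
    have h := hconv (h2 x hx).2 (h2 y hy).2 (by norm_num : (0 : ℝ) ≤ 1 / 2)
      (by norm_num : (0 : ℝ) ≤ 1 / 2) (by norm_num)
    simpa [smul_smul] using h
  have hnat : ∀ (n : ℕ), ∀ x ∈ F, (n : ℝ) • x ∈ F := by
    intro n x hx
    induction n with
    | zero => simpa using h0
    | succ n ih =>
      have h := hadd _ ih _ hx
      rw [Nat.cast_succ, add_smul, one_smul]
      exact h
  have hscale : ∀ (t : ℝ), 0 ≤ t → ∀ x ∈ F, t • x ∈ F := by
    intro t ht x hx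
    obtain ⟨n, hn⟩ := exists_nat_gt t
    have hnpos : (0 : ℝ) < n := lt_of_le_of_lt ht hn
    have h := hconv (hnat n x hx) h0 (div_nonneg ht hnpos.le)
      (sub_nonneg.2 ((div_le_one hnpos).2 hn.le)) (by ring)
    rw [smul_zero, add_zero, smul_smul, div_mul_cancel₀ _ hnpos.ne'] at h
    exact h
  have hdiff : ∃ p ∈ F, ∃ q ∈ F, g = p - q := by
    clear hgK
    induction hg using Submodule.span_induction with
    | mem x hx => exact ⟨x, hx, 0, h0, by simp⟩
    | zero => exact ⟨0, h0, 0, h0, by simp⟩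
    | add x y _ _ hx hy =>
      obtain ⟨p, hp, q, hq, rfl⟩ := hx
      obtain ⟨p', hp', q', hq', rfl⟩ := hy
      exact ⟨p + p', hadd _ hp _ hp', q + q', hadd _ hq _ hq', by abel⟩
    | smul r x _ hx =>
      obtain ⟨p, hp, q, hq, rfl⟩ := hx
      rcases le_total 0 r with hr | hr
      · exact ⟨r • p, hscale r hr _ hp, r • q, hscale r hr _ hq, smul_sub r p q⟩
      · exact ⟨(-r) • q, hscale _ (neg_nonneg.2 hr) _ hq, (-r) • p,
          hscale _ (neg_nonneg.2 hr) _ hp, by module⟩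
  obtain ⟨p, hp, q, hq, rfl⟩ := hdiff
  have h : (2 : ℝ) • (p - q) ∈ F := by
    refine (hface _ (hsm 2 (by norm_num) _ hgK) ((2 : ℝ) • q)
      (hsm 2 (by norm_num) _ (hsub hq)) ?_).1
    rw [← smul_add, sub_add_cancel, smul_smul]
    norm_num
    exact hp
  have := hscale (1 / 2) (by norm_num) _ h
  rw [smul_smul] at this
  norm_num at this
  exact this

/-- `ℓ_K` is attained. -/
theorem isGreatest_maxFaceChain [FiniteDimensional ℝ Y] (K : ProperCone ℝ Y) :
    IsGreatest (faceChainLengths (K : Set Y)) (maxFaceChain (K : Set Y)) := by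
  have hne : (faceChainLengths (K : Set Y)).Nonempty :=
    ⟨0, fun i => i.elim0, fun i => i.elim0, fun i => i.elim0⟩
  have hbdd : BddAbove (faceChainLengths (K : Set Y)) := by
    refine ⟨Module.finrank ℝ Y + 1, ?_⟩
    rintro k ⟨F, hF, hmono⟩
    have hdim : StrictMono fun i => Module.finrank ℝ (Submodule.span ℝ (F i)) := by
      intro i j hij
      refine Submodule.finrank_lt_finrank_of_lt (lt_of_le_of_ne
        (Submodule.span_mono (hmono hij).le) fun heq => (hmono hij).not_ge ?_)
      intro g hg
      exact (hF i).1.mem_of_mem_span (hF i).2 ((hF j).1.1 hg)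
        (heq ▸ Submodule.subset_span hg)
    have hinj : Function.Injective fun i : Fin k =>
        (⟨Module.finrank ℝ (Submodule.span ℝ (F i)),
          Nat.lt_succ_of_le (Submodule.finrank_le _)⟩ : Fin (Module.finrank ℝ Y + 1)) :=
      fun i j h => hdim.injective (congrArg Fin.val h)
    simpa using Fintype.card_le_of_injective _ hinj
  exact ⟨Nat.sSup_mem hne hbdd, fun k hk => le_csSup hbdd hk⟩

end FaceChains

end ConicLP

/-! All four certificates come from one statement, `exists_isPreStrict`: modulo `Lᗮ`, every `z` in
the dual of `K ∩ L` is the last term of a pre-strict sequence whose other terms lie in `Lᗮ`. Take a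
longest strict sequence in `Lᗮ`; lengths are bounded because each strict term cuts off a proper
face. If `C` is its last cut, maximality forces `C^* ∩ Lᗮ ⊆ C^⊥`. Under this condition `C^* + Lᗮ` is
closed, hence equals the dual of `C ∩ L` (`exists_mem_innerDual_sub_mem_orthogonal`).

Absence of strong infeasibility says exactly that `b`, or a solution of `A^* z = c`, lies in such a
dual. Infeasibility reduces to the same case by homogenizing an affine subspace that misses the cone
(`exists_isPreStrict_of_disjoint`).

Conversely, a feasible point is orthogonal to all earlier terms, so the last term cannot take the
value `-1` on it (`inner_last_nonneg`).

Certificates in the range of `A` become rows of a reformulation by Steinitz exchange, since strict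
sequences are linearly independent. -/

namespace ConicLP

/-! ### Closedness of projected dual cones -/

section Closedness

variable {Y : Type*} [NormedAddCommGroup Y] [InnerProductSpace ℝ Y] [FiniteDimensional ℝ Y]

/-- The image of a closed cone under a linear map whose kernel meets the cone only in `0` is
closed. -/
theorem isClosed_image_of_inter_ker (E : ProperCone ℝ Y) (f : Y →L[ℝ] Y)
    (h : ∀ x ∈ E, f x = 0 → x = 0) : IsClosed (f '' (E : Set Y)) := by
  -- `δ` is a positive lower bound of `‖f‖` on the unit vectors of `E`; by homogeneity, preimages in
  -- `E` of bounded sets are bounded.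
  obtain ⟨δ, hδ, hb⟩ := ((isCompact_sphere (0 : Y) 1).inter_right E.isClosed).exists_forall_le'
    (f := fun x => ‖f x‖) (a := 0) (by fun_prop) (by
      rintro x ⟨hx1, hx⟩
      refine norm_pos_iff.2 fun h0 => ?_
      rw [h x hx h0] at hx1
      simp at hx1)
  have hbound : ∀ x ∈ E, δ * ‖x‖ ≤ ‖f x‖ := by
    intro x hx
    rcases eq_or_ne x 0 with rfl | hne
    · simp
    have hpos := norm_pos_iff.2 hne
    have := hb (‖x‖⁻¹ • x) ⟨by simp [norm_smul, hpos.ne'],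
      E.smul_mem hx (inv_nonneg.2 hpos.le)⟩
    rw [map_smul, norm_smul, norm_inv, norm_norm, inv_mul_eq_div, le_div_iff₀ hpos] at this
    exact this
  refine isClosed_of_closure_subset fun z hz => ?_
  have hz' : z ∈ closure (Metric.ball z 1 ∩ f '' (E : Set Y)) :=
    Metric.isOpen_ball.inter_closure ⟨Metric.mem_ball_self one_pos, hz⟩
  have hcomp : IsCompact (f '' (Metric.closedBall 0 ((‖z‖ + 1) / δ) ∩ (E : Set Y))) :=
    ((isCompact_closedBall _ _).inter_right E.isClosed).image f.continuous
  refine Set.image_mono Set.inter_subset_right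
    (hcomp.isClosed.closure_subset_iff.2 ?_ hz')
  rintro _ ⟨hxz, x, hx, rfl⟩
  refine ⟨x, ⟨?_, hx⟩, rfl⟩
  rw [mem_closedBall_zero_iff, le_div_iff₀ hδ, mul_comm]
  refine (hbound x hx).trans ?_
  have := norm_sub_norm_le (f x) z
  rw [mem_ball_iff_norm] at hxz
  linarith

theorem mem_innerDual_of_mem_orthogonal_span {C : Set Y} {y : Y}
    (hy : y ∈ (Submodule.span ℝ C)ᗮ) : y ∈ ProperCone.innerDual C := fun _ hx =>
  (Submodule.inner_right_of_mem_orthogonal (Submodule.subset_span hx) hy).ge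

/-- If `C^* ∩ L^⊥ ⊆ C^⊥`, then `(C ∩ L)^* ⊆ C^* + L^⊥`. -/
theorem exists_mem_innerDual_sub_mem_orthogonal (C : ProperCone ℝ Y) (L : Submodule ℝ Y)
    (h : ∀ y ∈ ProperCone.innerDual (C : Set Y), y ∈ Lᗮ → y ∈ (Submodule.span ℝ (C : Set Y))ᗮ)
    {z : Y} (hz : z ∈ ProperCone.innerDual ((C : Set Y) ∩ L)) :
    ∃ y ∈ ProperCone.innerDual (C : Set Y), z - y ∈ Lᗮ := by
  set D := ProperCone.innerDual (C : Set Y) with hD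
  -- By `h`, the elements of `D` killed by `P` all lie in `V`. Removing the `V`-component stays in
  -- `D` and does not change `P`, so `P` maps `E = D ∩ Vᗮ` onto `P '' D` and is injective at `0`
  -- there.
  let V : Submodule ℝ Y := (Submodule.span ℝ (C : Set Y))ᗮ ⊓ Lᗮ
  let E : ProperCone ℝ Y := D ⊓ ProperCone.innerDual (V : Set Y)
  let P : Y →L[ℝ] Y := L.starProjection
  have hP : ∀ x, P x = 0 ↔ x ∈ Lᗮ := fun x => L.starProjection_apply_eq_zero_iff
  have hclosed : IsClosed (P '' (E : Set Y)) := by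
    refine isClosed_image_of_inter_ker E P fun x hx h0 => ?_
    have hxV : x ∈ V := ⟨h x hx.1 ((hP x).1 h0), (hP x).1 h0⟩
    have h1 : 0 ≤ ⟪-x, x⟫ := hx.2 (V.neg_mem hxV)
    rw [inner_neg_left] at h1
    exact inner_self_eq_zero.1 (le_antisymm (neg_nonneg.1 h1) real_inner_self_nonneg)
  have himage : ∀ x ∈ D, P x ∈ P '' (E : Set Y) := by
    intro x hx
    have hv : V.starProjection x ∈ V := V.starProjection_apply_mem x
    refine ⟨x - V.starProjection x, ⟨?_, ?_⟩, ?_⟩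
    · rw [sub_eq_add_neg]
      exact add_mem hx (mem_innerDual_of_mem_orthogonal_span (V.neg_mem hv).1)
    · intro w hw
      have h0 := V.starProjection_inner_eq_zero x w hw
      rw [real_inner_comm] at h0
      exact h0.ge
    · rw [map_sub, (hP _).2 hv.2, sub_zero]
  -- `D.map P` is the closure of the image, so separation applies; a test vector `w` gives `P w ∈
  -- D^* = C`, and `P w ∈ L`, where `z` is nonnegative.
  have hmem : P z ∈ D.map P := by
    rw [ProperCone.relative_hyperplane_separation]
    intro w hw
    have hPw : P w ∈ C := by
      rw [← ProperCone.innerDual_innerDual C]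
      intro x hx
      have : 0 ≤ ⟪x, P.adjoint w⟫ := hw hx
      rw [ContinuousLinearMap.adjoint_inner_right, L.inner_starProjection_left_eq_right] at this
      exact this
    have : 0 ≤ ⟪P w, z⟫ := hz ⟨hPw, L.starProjection_apply_mem w⟩
    rwa [real_inner_comm, ← L.inner_starProjection_left_eq_right] at this
  have hsub : ((D.map P : ProperCone ℝ Y) : Set Y) ⊆ P '' (E : Set Y) := by
    refine hclosed.closure_subset_iff.2 ?_
    rintro _ ⟨x, hx, rfl⟩
    exact himage x hx
  obtain ⟨y, hy, hyz⟩ := hsub hmem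
  exact ⟨y, hy.1, (hP _).1 (by rw [map_sub, hyz, sub_self])⟩

end Closedness

/-! ### Facial reduction sequences -/

section Sequences

variable {Y : Type*} [NormedAddCommGroup Y] [InnerProductSpace ℝ Y] [FiniteDimensional ℝ Y]

/-- `K ∩ y_1^⊥ ∩ ⋯ ∩ y_k^⊥` as a closed cone. -/
noncomputable def cutCone (K : ProperCone ℝ Y) {k : ℕ} (y : Fin k → Y) : ProperCone ℝ Y :=
  K ⊓ ProperCone.innerDual (Submodule.span ℝ (Set.range y) : Set Y)

/-- The dual cone of a subspace is its orthogonal complement, because the subspace contains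
negatives. -/
theorem mem_cutCone {K : ProperCone ℝ Y} {k : ℕ} {y : Fin k → Y} {x : Y} :
    x ∈ cutCone K y ↔ x ∈ K ∧ ∀ j, ⟪y j, x⟫ = 0 := by
  refine and_congr_right fun _ => ⟨fun h j => ?_, fun h w hw => ?_⟩
  · have hj : y j ∈ Submodule.span ℝ (Set.range y) := Submodule.subset_span ⟨j, rfl⟩
    have h1 : 0 ≤ ⟪y j, x⟫ := h hj
    have h2 : 0 ≤ ⟪-y j, x⟫ := h (Submodule.neg_mem _ hj)
    rw [inner_neg_left] at h2
    linarith
  · refine (Submodule.span_induction (p := fun w _ => ⟪w, x⟫ = 0) ?_ ?_ ?_ ?_ hw).ge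
    · rintro _ ⟨j, rfl⟩
      exact h j
    · exact inner_zero_left _
    · intro u v _ _ hu hv
      rw [inner_add_left, hu, hv, add_zero]
    · intro a u _ hu
      rw [real_inner_smul_left, hu, mul_zero]

theorem cutBefore_last (K : ProperCone ℝ Y) {k : ℕ} (y : Fin (k + 1) → Y) :
    cutBefore (K : Set Y) y (Fin.last k) = cutCone K (Fin.init y) := by
  ext x
  refine Iff.trans (and_congr_right fun _ => ⟨fun h j => h _ (Fin.castSucc_lt_last j),
    fun h j hj => ?_⟩) mem_cutCone.symm
  obtain ⟨j, rfl⟩ := Fin.eq_castSucc_of_ne_last hj.ne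
  exact h j

omit [FiniteDimensional ℝ Y] in
theorem cutBefore_castSucc (K : Set Y) {k : ℕ} (y : Fin (k + 1) → Y) (i : Fin k) :
    cutBefore K y i.castSucc = cutBefore K (Fin.init y) i := by
  ext x
  refine and_congr_right fun _ => ⟨fun h j hj => h _ (Fin.castSucc_lt_castSucc_iff.2 hj),
    fun h j hj => ?_⟩
  obtain ⟨j, rfl⟩ := Fin.eq_castSucc_of_ne_last (hj.trans (Fin.castSucc_lt_last i)).ne
  exact h j (Fin.castSucc_lt_castSucc_iff.1 hj)

theorem IsStrict.mem_FR {K : Set Y} {k : ℕ} {y : Fin k → Y} (h : IsStrict K y) : y ∈ FR K k :=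
  fun i => (h i).1

theorem mem_FR_succ {K : ProperCone ℝ Y} {k : ℕ} {y : Fin (k + 1) → Y} :
    y ∈ FR (K : Set Y) (k + 1) ↔ Fin.init y ∈ FR (K : Set Y) k ∧
      y (Fin.last k) ∈ ProperCone.innerDual (cutCone K (Fin.init y) : Set Y) := by
  simp only [FR, Set.mem_ofPred_eq, Fin.forall_fin_succ', cutBefore_last, cutBefore_castSucc,
    Fin.init]

theorem isStrict_succ {K : ProperCone ℝ Y} {k : ℕ} {y : Fin (k + 1) → Y} :
    IsStrict (K : Set Y) y ↔ IsStrict (K : Set Y) (Fin.init y) ∧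
      y (Fin.last k) ∈ dualMinusPerp (cutCone K (Fin.init y) : Set Y) := by
  simp only [IsStrict, Fin.forall_fin_succ', cutBefore_last, cutBefore_castSucc, Fin.init]

theorem isPreStrict_iff {K : ProperCone ℝ Y} {k : ℕ} {y : Fin (k + 1) → Y} :
    IsPreStrict (K : Set Y) y ↔ IsStrict (K : Set Y) (Fin.init y) ∧
      y (Fin.last k) ∈ ProperCone.innerDual (cutCone K (Fin.init y) : Set Y) := by
  rw [IsPreStrict, mem_FR_succ]
  exact ⟨fun h => ⟨h.2, h.1.2⟩, fun h => ⟨⟨h.1.mem_FR, h.2⟩, h.1⟩⟩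

/-- The cuts of a cone by a facial reduction sequence are faces. -/
theorem isFace_cutCone (K : ProperCone ℝ Y) {k : ℕ} {y : Fin k → Y}
    (hy : y ∈ FR (K : Set Y) k) : IsFace (K : Set Y) (cutCone K y) := by
  refine ⟨fun x hx => hx.1, (cutCone K y).convex, ?_⟩
  induction k with
  | zero => exact fun u hu v hv _ => ⟨mem_cutCone.2 ⟨hu, fun j => j.elim0⟩,
      mem_cutCone.2 ⟨hv, fun j => j.elim0⟩⟩
  | succ k ih =>
    intro u hu v hv huv
    obtain ⟨hinit, hlast⟩ := mem_FR_succ.1 hy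
    obtain ⟨hK, hcut⟩ := mem_cutCone.1 huv
    obtain ⟨hu', hv'⟩ := ih hinit u hu v hv (mem_cutCone.2 ⟨hK, fun j => hcut j.castSucc⟩)
    have h1 : 0 ≤ ⟪u, y (Fin.last k)⟫ := hlast hu'
    have h2 : 0 ≤ ⟪v, y (Fin.last k)⟫ := hlast hv'
    -- Two nonnegative numbers with zero sum both vanish.
    have h3 := hcut (Fin.last k)
    rw [real_inner_smul_right, inner_add_right] at h3
    rw [real_inner_comm] at h1 h2
    constructor <;> refine mem_cutCone.2 ⟨by assumption, Fin.forall_fin_succ'.2 ⟨?_, ?_⟩⟩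
    · exact (mem_cutCone.1 hu').2
    · linarith
    · exact (mem_cutCone.1 hv').2
    · linarith

/-- A strict facial reduction sequence of length `k` yields a chain of `k + 1` faces that starts
with the last cut. -/
theorem IsStrict.exists_face_chain (K : ProperCone ℝ Y) {k : ℕ} {y : Fin k → Y}
    (hy : IsStrict (K : Set Y) y) : ∃ F : Fin (k + 1) → Set Y,
      (∀ i, IsFace (K : Set Y) (F i) ∧ (F i).Nonempty) ∧ StrictMono F ∧ F 0 = cutCone K y := by
  induction k with
  | zero =>
    exact ⟨fun _ => cutCone K y, fun _ => ⟨isFace_cutCone K hy.mem_FR, (cutCone K y).nonempty⟩,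
      Fin.strictMono_iff_lt_succ.2 fun i => i.elim0, rfl⟩
  | succ k ih =>
    obtain ⟨hinit, hlast, hperp⟩ := isStrict_succ.1 hy
    obtain ⟨F, hF, hmono, h0⟩ := ih hinit
    refine ⟨Fin.cons (cutCone K y) F, Fin.forall_fin_succ.2
      ⟨⟨isFace_cutCone K hy.mem_FR, (cutCone K y).nonempty⟩, hF⟩, ?_, rfl⟩
    refine Fin.strictMono_iff_lt_succ.2 (Fin.cases ?_ fun i => ?_)
    · simp only [Fin.castSucc_zero, Fin.cons_zero, Fin.cons_succ, h0]
      have hle : (cutCone K y : Set Y) ≤ cutCone K (Fin.init y) := fun x hx =>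
        mem_cutCone.2 ⟨hx.1, fun j => (mem_cutCone.1 hx).2 j.castSucc⟩
      -- If the last term cut off nothing, it would be orthogonal to the previous cut, against
      -- strictness.
      refine lt_of_le_not_ge hle fun hge => hperp ?_
      rw [Submodule.mem_orthogonal]
      intro u hu
      refine Submodule.span_induction (p := fun u _ => ⟪u, y (Fin.last k)⟫ = 0) ?_ ?_ ?_ ?_ hu
      · intro x hx
        rw [real_inner_comm]
        exact (mem_cutCone.1 (hge hx)).2 _
      · exact inner_zero_left _
      · intro u v _ _ hu hv
        rw [inner_add_left, hu, hv, add_zero]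
      · intro a u _ hu
        rw [real_inner_smul_left, hu, mul_zero]
    · rw [← Fin.succ_castSucc, Fin.cons_succ, Fin.cons_succ]
      exact hmono i.castSucc_lt_succ

/-- The extra face is `K` itself; this is the source of the `- 1` in every length bound. -/
theorem IsStrict.succ_le_maxFaceChain {K : ProperCone ℝ Y} {k : ℕ} {y : Fin k → Y}
    (hy : IsStrict (K : Set Y) y) : k + 1 ≤ maxFaceChain (K : Set Y) := by
  obtain ⟨F, hF, hmono, -⟩ := hy.exists_face_chain
  exact (isGreatest_maxFaceChain K).2 ⟨F, hF, hmono⟩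

/-- The terms of a strict facial reduction sequence are linearly independent. -/
theorem IsStrict.linearIndependent {K : ProperCone ℝ Y} {k : ℕ} {y : Fin k → Y}
    (hy : IsStrict (K : Set Y) y) : LinearIndependent ℝ y := by
  induction k with
  | zero => exact linearIndependent_empty_type
  | succ k ih =>
    obtain ⟨hinit, -, hperp⟩ := isStrict_succ.1 hy
    rw [linearIndependent_finSucc']
    refine ⟨ih hinit, fun hmem => hperp ?_⟩
    -- The earlier terms are orthogonal to the current cut, whereas strictness forbids this for the
    -- next term.
    have hle : Submodule.span ℝ (Set.range (Fin.init y)) ≤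
        (Submodule.span ℝ (cutCone K (Fin.init y) : Set Y))ᗮ := by
      rw [← Submodule.isOrtho_iff_le, Submodule.isOrtho_span]
      rintro _ ⟨j, rfl⟩ x hx
      exact (mem_cutCone.1 hx).2 j
    exact hle hmem

/-- Facial reduction: `(K ∩ L)^*` consists of the last terms, modulo `L^⊥`, of pre-strict
sequences whose other terms lie in `L^⊥`. -/
theorem exists_isPreStrict (K : ProperCone ℝ Y) (L : Submodule ℝ Y) {z : Y}
    (hz : z ∈ ProperCone.innerDual ((K : Set Y) ∩ L)) :
    ∃ (k : ℕ) (y : Fin (k + 1) → Y), k ≤ maxFaceChain (K : Set Y) - 1 ∧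
      IsPreStrict (K : Set Y) y ∧ (∀ i : Fin k, y i.castSucc ∈ Lᗮ) ∧
      z - y (Fin.last k) ∈ Lᗮ := by
  let S : Set ℕ := {k | ∃ y : Fin k → Y, IsStrict (K : Set Y) y ∧ ∀ i, y i ∈ Lᗮ}
  have hS0 : S.Nonempty := ⟨0, fun i => i.elim0, fun i => i.elim0, fun i => i.elim0⟩
  have hSb : BddAbove S := by
    refine ⟨maxFaceChain (K : Set Y), ?_⟩
    rintro k ⟨y, hy, -⟩
    exact (Nat.le_succ k).trans hy.succ_le_maxFaceChain
  obtain ⟨y, hy, hyL⟩ := Nat.sSup_mem hS0 hSb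
  have hmax : ∀ w ∈ ProperCone.innerDual (cutCone K y : Set Y), w ∈ Lᗮ →
      w ∈ (Submodule.span ℝ (cutCone K y : Set Y))ᗮ := by
    intro w hw hwL
    by_contra hperp
    -- Otherwise `w` would extend the longest strict sequence.
    have hmem : sSup S + 1 ∈ S := by
      refine ⟨Fin.snoc y w, isStrict_succ.2 ?_, Fin.forall_fin_succ'.2 ?_⟩
      · rw [Fin.init_snoc, Fin.snoc_last]
        exact ⟨hy, hw, hperp⟩
      · simpa using ⟨hyL, hwL⟩
    exact absurd (le_csSup hSb hmem) (by omega)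
  obtain ⟨w, hw, hzw⟩ := exists_mem_innerDual_sub_mem_orthogonal (cutCone K y) L hmax
    (z := z) (fun x hx => hz ⟨hx.1.1, hx.2⟩)
  refine ⟨sSup S, Fin.snoc y w, ?_, isPreStrict_iff.2 ?_, ?_, ?_⟩
  · have := hy.succ_le_maxFaceChain
    omega
  · rw [Fin.init_snoc, Fin.snoc_last]
    exact ⟨hy, hw⟩
  · simpa using hyL
  · simpa using hzw

/-- The last term of a facial reduction sequence is nonnegative on the points of the cone that
are orthogonal to the other terms. -/
theorem inner_last_nonneg {K : ProperCone ℝ Y} {k : ℕ} {y : Fin (k + 1) → Y}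
    (hy : y ∈ FR (K : Set Y) (k + 1)) {x : Y} (hx : x ∈ K)
    (h : ∀ i : Fin k, ⟪y i.castSucc, x⟫ = 0) : 0 ≤ ⟪y (Fin.last k), x⟫ := by
  rw [real_inner_comm]
  exact (mem_FR_succ.1 hy).2 (mem_cutCone.2 ⟨hx, h⟩)

end Sequences

/-! ### Affine subspaces and linear equations -/

section AffineSystems

variable {Y : Type*} [NormedAddCommGroup Y] [InnerProductSpace ℝ Y] [FiniteDimensional ℝ Y]

theorem exists_mem_orthogonal_inner_eq_neg_one {S : Submodule ℝ Y} {w : Y} (hw : w ∉ S) :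
    ∃ z ∈ Sᗮ, ⟪w, z⟫ = -1 := by
  rw [← S.orthogonal_orthogonal, Submodule.mem_orthogonal'] at hw
  push Not at hw
  obtain ⟨z, hz, hne⟩ := hw
  exact ⟨(-⟪w, z⟫⁻¹) • z, Sᗮ.smul_mem _ hz, by
    rw [real_inner_smul_right, neg_mul, inv_mul_cancel₀ hne]⟩

/-- If the affine subspace `w + S` misses the cone, a pre-strict sequence certifies it. -/
theorem exists_isPreStrict_of_disjoint (C : ProperCone ℝ Y) (S : Submodule ℝ Y) (w : Y)
    (h : ∀ x ∈ S, w + x ∉ C) :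
    ∃ (k : ℕ) (y : Fin (k + 1) → Y), k ≤ maxFaceChain (C : Set Y) - 1 ∧
      IsPreStrict (C : Set Y) y ∧ (∀ i : Fin k, y i.castSucc ∈ Sᗮ ∧ ⟪w, y i.castSucc⟫ = 0) ∧
      y (Fin.last k) ∈ Sᗮ ∧ ⟪w, y (Fin.last k)⟫ = -1 := by
  have hw : w ∉ S := fun hw => h (-w) (S.neg_mem hw) (by simp)
  obtain ⟨z, hzS, hzw⟩ := exists_mem_orthogonal_inner_eq_neg_one hw
  -- Homogenization: a cone point `s + t • w` with `t > 0` rescales into `w + S`, so `t ≤ 0`, and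
  -- `z` takes the value `-t` there.
  have hz : z ∈ ProperCone.innerDual
      ((C : Set Y) ∩ (S ⊔ Submodule.span ℝ {w} : Submodule ℝ Y)) := by
    rintro x ⟨hxC, hx⟩
    obtain ⟨s, hs, _, hv, rfl⟩ := Submodule.mem_sup.1 hx
    obtain ⟨t, rfl⟩ := Submodule.mem_span_singleton.1 hv
    change 0 ≤ ⟪s + t • w, z⟫
    rw [inner_add_left, Submodule.inner_right_of_mem_orthogonal hs hzS, real_inner_smul_left, hzw]
    have ht : ¬ 0 < t := fun ht => h (t⁻¹ • s) (S.smul_mem _ hs) (by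
      have := C.smul_mem hxC (inv_nonneg.2 ht.le)
      rwa [smul_add, inv_smul_smul₀ ht.ne', add_comm] at this)
    linarith
  obtain ⟨k, y, hk, hy, hyL, hlast⟩ := exists_isPreStrict C _ hz
  have hmem : ∀ {u : Y}, u ∈ (S ⊔ Submodule.span ℝ {w})ᗮ → u ∈ Sᗮ ∧ ⟪w, u⟫ = 0 := fun hu =>
    ⟨Submodule.orthogonal_le le_sup_left hu, Submodule.inner_right_of_mem_orthogonal
      (Submodule.mem_sup_right (Submodule.mem_span_singleton_self w)) hu⟩
  obtain ⟨h1, h2⟩ := hmem hlast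
  refine ⟨k, y, hk, hy, fun i => hmem (hyL i), ?_, ?_⟩
  · simpa using Sᗮ.sub_mem hzS h1
  · rw [inner_sub_right, hzw] at h2
    linarith

omit [FiniteDimensional ℝ Y] in
/-- A system of linear equations is solvable or refuted by a combination of its rows. -/
theorem exists_inner_eq_or_exists_sum_eq_zero {ι : Type*} [Fintype ι] [DecidableEq ι]
    (v : ι → Y) (c : ι → ℝ) :
    (∃ z, ∀ i, ⟪v i, z⟫ = c i) ∨ ∃ l : ι → ℝ, ∑ i, l i • v i = 0 ∧ ∑ i, c i * l i = -1 := by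
  let T : Y →ₗ[ℝ] ι → ℝ := LinearMap.pi fun i => innerₗ Y (v i)
  by_cases hc : c ∈ LinearMap.range T
  · obtain ⟨z, rfl⟩ := hc
    exact Or.inl ⟨z, fun i => rfl⟩
  · right
    -- The coordinates of `f`, scaled so that `c` is sent to `-1`, are the refuting coefficients.
    obtain ⟨f, hf, hker⟩ := Submodule.exists_le_ker_of_notMem hc
    have hexp : ∀ x : ι → ℝ, f x = ∑ i, x i * f (fun j => if i = j then 1 else 0) :=
      fun x => f.pi_apply_eq_sum_univ x
    refine ⟨fun i => -(f c)⁻¹ * f (fun j => if i = j then 1 else 0), ?_, ?_⟩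
    · refine ext_inner_right ℝ fun z => ?_
      have h0 : f (T z) = 0 := hker ⟨z, rfl⟩
      have h1 : ⟪∑ i, (-(f c)⁻¹ * f (fun j => if i = j then 1 else 0)) • v i, z⟫ =
          -(f c)⁻¹ * f (T z) := by
        rw [hexp (T z), sum_inner, Finset.mul_sum]
        refine Finset.sum_congr rfl fun i _ => ?_
        rw [real_inner_smul_left]
        change _ * ⟪v i, z⟫ = _ * (⟪v i, z⟫ * _)
        ring
      rw [h1, h0, mul_zero, inner_zero_left]
    · have : ∀ i, c i * (-(f c)⁻¹ * f (fun j => if i = j then 1 else 0)) =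
          -(f c)⁻¹ * (c i * f (fun j => if i = j then 1 else 0)) := fun i => by ring
      simp_rw [this]
      rw [← Finset.mul_sum, ← hexp, neg_mul, inv_mul_cancel₀ hf]

end AffineSystems

/-! ### Row operations -/

section Reformulations

variable {Y : Type*} [NormedAddCommGroup Y] [InnerProductSpace ℝ Y] {m : ℕ}

theorem Data.A_eq_linearCombination (d : Data m Y) (x : Fin m → ℝ) :
    d.A x = Fintype.linearCombination ℝ d.a x := rfl

theorem Data.inner_A (d : Data m Y) (x : Fin m → ℝ) (y : Y) :
    ⟪d.A x, y⟫ = ∑ i, d.Astar y i * x i := by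
  rw [Data.A, sum_inner]
  refine Finset.sum_congr rfl fun i _ => ?_
  rw [real_inner_smul_left, mul_comm]
  rfl

theorem Data.mem_span_iff {d : Data m Y} {y : Y} :
    y ∈ Submodule.span ℝ (Set.range d.a) ↔ ∃ x, d.A x = y :=
  Submodule.mem_span_range_iff_exists_fun ℝ

theorem Data.mem_orthogonal_iff {d : Data m Y} {y : Y} :
    y ∈ (Submodule.span ℝ (Set.range d.a))ᗮ ↔ d.Astar y = 0 := by
  refine ⟨fun h => funext fun i =>
    Submodule.inner_right_of_mem_orthogonal (Submodule.subset_span (Set.mem_range_self i)) h,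
    fun h => ?_⟩
  rw [Submodule.mem_orthogonal]
  intro u hu
  obtain ⟨x, rfl⟩ := Data.mem_span_iff.1 hu
  simp [d.inner_A, h]

theorem IsReformulation.astar_eq {d d' : Data m Y} (h : IsReformulation d d') {y : Y}
    (hy : d.Astar y = d.c) : d'.Astar y = d'.c := by
  induction h with
  | refl => exact hy
  | @tail d _ _ hop ih =>
    rcases hop with ⟨i, l, hl⟩ | ⟨i, j, hij⟩ | ⟨μ⟩
    · funext j
      rcases eq_or_ne j i with rfl | hne
      · change ⟪Function.update d.a j (d.A l) j, y⟫ = Function.update d.c j _ j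
        rw [Function.update_self, Function.update_self, d.inner_A, ih]
      · simpa only [Data.Astar, Function.update_of_ne hne] using congrFun ih j
    · exact funext fun _ => congrFun ih _
    · exact ih

/-- A shift changes `b` only by an element of the range of `A`, which is orthogonal to `y`. -/
theorem IsReformulation.astar_eq_zero {d d' : Data m Y} (h : IsReformulation d d') {y : Y}
    (hy : d.Astar y = 0) : d'.Astar y = 0 ∧ ⟪d'.b, y⟫ = ⟪d.b, y⟫ := by
  induction h with
  | refl => exact ⟨hy, rfl⟩
  | @tail d _ _ hop ih =>
    rcases hop with ⟨i, l, hl⟩ | ⟨i, j, hij⟩ | ⟨μ⟩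
    · refine ⟨funext fun j => ?_, ih.2⟩
      rcases eq_or_ne j i with rfl | hne
      · change ⟪Function.update d.a j (d.A l) j, y⟫ = 0
        rw [Function.update_self, d.inner_A, ih.1]
        simp
      · simpa only [Data.Astar, Function.update_of_ne hne] using congrFun ih.1 j
    · exact ⟨funext fun _ => congrFun ih.1 _, ih.2⟩
    · refine ⟨ih.1, ?_⟩
      simp [inner_add_left, d.inner_A, ih.1, ih.2]

/-- The data whose rows are the combinations of the rows of `d` with coefficients `M i`. -/
def Data.transform (d : Data m Y) (M : Fin m → Fin m → ℝ) : Data m Y :=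
  ⟨fun i => d.A (M i), d.b, fun i => ∑ j, d.c j * M i j⟩

theorem Data.transform_single (d : Data m Y) : d.transform (fun i => Pi.single i 1) = d := by
  rcases d with ⟨a, b, c⟩
  simp [Data.transform, Data.A, Pi.single_apply]

/-- Row replacement acts on the coefficient vectors alone, so the exchange argument can be run on
`M` with `d` fixed. -/
theorem Data.transform_update (d : Data m Y) (M : Fin m → Fin m → ℝ) (j : Fin m)
    (μ : Fin m → ℝ) :
    d.transform (Function.update M j (∑ i, μ i • M i)) =
      ⟨Function.update (d.transform M).a j ((d.transform M).A μ), (d.transform M).b,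
        Function.update (d.transform M).c j (∑ i, (d.transform M).c i * μ i)⟩ := by
  have ha : d.A (∑ i, μ i • M i) = (d.transform M).A μ := by
    simp only [d.A_eq_linearCombination, map_sum, map_smul]
    rfl
  have hc : ∑ l, d.c l * (∑ i, μ i • M i) l = ∑ i, (d.transform M).c i * μ i := by
    simp only [Data.transform, Finset.sum_apply, Pi.smul_apply, smul_eq_mul, Finset.mul_sum,
      Finset.sum_mul]
    rw [Finset.sum_comm]
    exact Finset.sum_congr rfl fun i _ => Finset.sum_congr rfl fun l _ => by ring
  rw [← ha, ← hc]
  simp only [Data.transform, Data.mk.injEq, true_and]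
  constructor <;> funext i <;> rcases eq_or_ne i j with rfl | hne <;> simp [*]

theorem Data.transform_swap (d : Data m Y) (M : Fin m → Fin m → ℝ) (i j : Fin m) :
    IsReformulation (d.transform M) (d.transform (M ∘ Equiv.swap i j)) := by
  rcases eq_or_ne i j with rfl | hij
  · rw [Equiv.swap_self]
    exact Relation.ReflTransGen.refl
  · exact Relation.ReflTransGen.single (RowOp.switch _ i j hij)

theorem span_range_update_eq_top {V : Type*} [AddCommGroup V] [Module ℝ V] {M : Fin m → V}
    (hM : Submodule.span ℝ (Set.range M) = ⊤) (j : Fin m) {μ : Fin m → ℝ} (hμ : μ j ≠ 0) :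
    Submodule.span ℝ (Set.range (Function.update M j (∑ i, μ i • M i))) = ⊤ := by
  set N := Function.update M j (∑ i, μ i • M i) with hN
  have hmem : ∀ i, N i ∈ Submodule.span ℝ (Set.range N) := fun i =>
    Submodule.subset_span ⟨i, rfl⟩
  have hne : ∀ i, i ≠ j → M i ∈ Submodule.span ℝ (Set.range N) := fun i hi => by
    simpa [hN, hi] using hmem i
  rw [eq_top_iff, ← hM, Submodule.span_le]
  rintro _ ⟨i, rfl⟩
  rcases eq_or_ne i j with rfl | hi
  · have h1 := hmem i
    rw [hN, Function.update_self, ← hN, ← Finset.add_sum_erase _ _ (Finset.mem_univ i),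
      Submodule.add_mem_iff_left _ (Submodule.sum_mem _ fun l hl =>
        Submodule.smul_mem _ _ (hne l (Finset.ne_of_mem_erase hl))),
      Submodule.smul_mem_iff _ hμ] at h1
    exact h1
  · exact hne i hi

/-- Linearly independent combinations of the rows can be made the first rows. -/
theorem exists_isReformulation_transform (d : Data m Y) {k : ℕ} (hk : k ≤ m)
    (l : Fin k → Fin m → ℝ) (hl : LinearIndependent ℝ l) :
    ∃ M : Fin m → Fin m → ℝ, IsReformulation d (d.transform M) ∧
      Submodule.span ℝ (Set.range M) = ⊤ ∧ ∀ i, M (Fin.castLE hk i) = l i := by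
  induction k with
  | zero =>
    refine ⟨fun i => Pi.single i 1, ?_, ?_, fun i => i.elim0⟩
    · rw [d.transform_single]
      exact Relation.ReflTransGen.refl
    · convert (Pi.basisFun ℝ (Fin m)).span_eq
      exact (Pi.basisFun_apply ℝ (Fin m) _).symm
  | succ k ih =>
    rw [linearIndependent_finSucc'] at hl
    obtain ⟨M, hd, hspan, hM⟩ := ih (Nat.le_of_succ_le hk) (Fin.init l) hl.1
    have hlast : l (Fin.last k) ∈ Submodule.span ℝ (Set.range M) := hspan ▸ Submodule.mem_top
    obtain ⟨μ, hμ⟩ := (Submodule.mem_span_range_iff_exists_fun ℝ).1 hlast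
    -- Steinitz exchange: the new vector is outside the span of the first `k` rows, so it involves
    -- some row `p ≥ k`. Swapping `p` into position `k` leaves the first `k` rows alone.
    obtain ⟨p, hpk, hp⟩ : ∃ p : Fin m, k ≤ p ∧ μ p ≠ 0 := by
      by_contra! hcon
      refine hl.2 (hμ ▸ Submodule.sum_mem _ fun p _ => ?_)
      rcases lt_or_ge (p : ℕ) k with hp | hp
      · exact Submodule.smul_mem _ _ (Submodule.subset_span ⟨⟨p, hp⟩, (hM ⟨p, hp⟩).symm⟩)
      · rw [hcon p hp, zero_smul]
        exact Submodule.zero_mem _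
    let j : Fin m := ⟨k, hk⟩
    let σ := Equiv.swap j p
    have hsum : ∑ i, (μ ∘ σ) i • (M ∘ σ) i = l (Fin.last k) := by
      rw [← hμ]
      exact Equiv.sum_comp σ fun i => μ i • M i
    have hj : (μ ∘ σ) j ≠ 0 := by simpa [σ] using hp
    have hσ : Submodule.span ℝ (Set.range (M ∘ σ)) = ⊤ := by
      rw [σ.surjective.range_comp, hspan]
    refine ⟨Function.update (M ∘ σ) j (∑ i, (μ ∘ σ) i • (M ∘ σ) i), ?_,
      span_range_update_eq_top hσ j hj, Fin.forall_fin_succ'.2 ⟨fun i => ?_, ?_⟩⟩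
    · rw [d.transform_update]
      exact (hd.trans (d.transform_swap M j p)).tail (RowOp.replace _ j _ hj)
    · have h1 : Fin.castLE hk i.castSucc ≠ j := fun h =>
        i.isLt.ne (congrArg Fin.val h)
      have h2 : Fin.castLE hk i.castSucc ≠ p := fun h =>
        (i.isLt.trans_le hpk).ne (congrArg Fin.val h)
      rw [Function.update_of_ne h1, Function.comp_apply, Equiv.swap_apply_of_ne_of_ne h1 h2]
      exact hM i
    · have h1 : Fin.castLE hk (Fin.last k) = j := rfl
      rw [h1, Function.update_self, hsum]

theorem exists_isReformulation (d : Data m Y) {k : ℕ} (l : Fin k → Fin m → ℝ)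
    (hl : LinearIndependent ℝ l) :
    ∃ (hk : k ≤ m) (d' : Data m Y), IsReformulation d d' ∧ d'.b = d.b ∧
      ∀ i, d'.a (Fin.castLE hk i) = d.A (l i) ∧
        d'.c (Fin.castLE hk i) = ∑ j, d.c j * l i j := by
  have hk : k ≤ m := by simpa using hl.fintype_card_le_finrank
  obtain ⟨M, hd, -, hM⟩ := exists_isReformulation_transform d hk l hl
  refine ⟨hk, d.transform M, hd, rfl, fun i => ?_⟩
  rw [← hM i]
  exact ⟨rfl, rfl⟩

end Reformulations

/-! ### Certificates for the conic systems -/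

section Infeasibility

variable {Y : Type*} [NormedAddCommGroup Y] [InnerProductSpace ℝ Y] [FiniteDimensional ℝ Y]
  {m : ℕ} {K : ProperCone ℝ Y} {d : Data m Y}

/-- The solutions of `A^* y = c`, if any, form a translate of the kernel of `A^*`, which misses the
dual cone. The certificate is orthogonal to this kernel, hence lies in the range of `A`. -/
theorem exists_of_not_dFeasible (h : ¬ DFeasible K d) :
    ∃ d' : Data m Y, IsReformulation d d' ∧ ∃ (k : ℕ) (hk : k + 1 ≤ m),
      k ≤ maxFaceChain (ProperCone.innerDual (K : Set Y) : Set Y) - 1 ∧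
      IsPreStrict (ProperCone.innerDual (K : Set Y) : Set Y)
        (fun i : Fin (k + 1) => d'.a (Fin.castLE hk i)) ∧
      (∀ i : Fin k, d'.c (Fin.castLE hk i.castSucc) = 0) ∧
      d'.c (Fin.castLE hk (Fin.last k)) = -1 := by
  obtain ⟨k, l, hk, hpre, h0, h1⟩ : ∃ (k : ℕ) (l : Fin (k + 1) → Fin m → ℝ),
      k ≤ maxFaceChain (ProperCone.innerDual (K : Set Y) : Set Y) - 1 ∧
      IsPreStrict (ProperCone.innerDual (K : Set Y) : Set Y) (fun i => d.A (l i)) ∧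
      (∀ i : Fin k, ∑ j, d.c j * l i.castSucc j = 0) ∧ ∑ j, d.c j * l (Fin.last k) j = -1 := by
    rcases exists_inner_eq_or_exists_sum_eq_zero d.a d.c with ⟨w, hw⟩ | ⟨l, hl, hc⟩
    · have hw : d.Astar w = d.c := funext hw
      obtain ⟨k, y, hk, hy, hy0, hy1, hyw⟩ := exists_isPreStrict_of_disjoint
        (ProperCone.innerDual (K : Set Y)) (Submodule.span ℝ (Set.range d.a))ᗮ w
        (fun x hx hmem => h ⟨w + x, hmem, by
          rw [← hw]
          funext i
          have := congrFun (Data.mem_orthogonal_iff.1 hx) i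
          simp only [Data.Astar] at this ⊢
          rw [inner_add_right, this]
          simp⟩)
      rw [Submodule.orthogonal_orthogonal] at hy0 hy1
      have hex : ∀ i, ∃ l, d.A l = y i := Fin.forall_fin_succ'.2
        ⟨fun i => Data.mem_span_iff.1 (hy0 i).1, Data.mem_span_iff.1 hy1⟩
      choose l hl using hex
      have hc : ∀ i, ∑ j, d.c j * l i j = ⟪w, y i⟫ := fun i => by
        rw [← hl, real_inner_comm, d.inner_A, hw]
      refine ⟨k, l, hk, ?_, fun i => (hc _).trans (hy0 i).2, (hc _).trans hyw⟩
      simp_rw [hl]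
      exact hy
    -- If the linear equations alone are inconsistent, the single row `0 = -1` suffices.
    · refine ⟨0, fun _ => l, Nat.zero_le _, isPreStrict_iff.2 ⟨fun i => i.elim0, ?_⟩,
        fun i => i.elim0, hc⟩
      have : d.A l = 0 := hl
      rw [this]
      exact zero_mem _
  have hind : LinearIndependent ℝ l := by
    rw [linearIndependent_finSucc']
    constructor
    · exact (isPreStrict_iff.1 hpre).1.linearIndependent.of_comp (Fintype.linearCombination ℝ d.a)
    -- The last vector may have a dependent image under `A`; pairing with `c` separates it, being
    -- `0` on the others and `-1` on it.
    · intro hmem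
      have hle : Submodule.span ℝ (Set.range (Fin.init l)) ≤
          LinearMap.ker (Fintype.linearCombination ℝ d.c) := by
        rw [Submodule.span_le]
        rintro _ ⟨i, rfl⟩
        rw [SetLike.mem_coe, LinearMap.mem_ker, Fintype.linearCombination_apply, ← h0 i]
        exact Finset.sum_congr rfl fun j _ => mul_comm _ _
      have h2 : ∑ j, l (Fin.last k) j * d.c j = 0 := hle hmem
      rw [Finset.sum_congr rfl fun j _ => mul_comm (d.c j) _, h2] at h1
      norm_num at h1
  obtain ⟨hkm, d', hd', -, hrow⟩ := exists_isReformulation d l hind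
  refine ⟨d', hd', k, hkm, hk, ?_, fun i => (hrow _).2.trans (h0 i), (hrow _).2.trans h1⟩
  simp_rw [fun i => (hrow i).1]
  exact hpre

theorem not_dFeasible_of_exists {d' : Data m Y} (hd' : IsReformulation d d') {k : ℕ}
    (hk : k + 1 ≤ m)
    (hFR : (fun i : Fin (k + 1) => d'.a (Fin.castLE hk i)) ∈
      FR (ProperCone.innerDual (K : Set Y) : Set Y) (k + 1))
    (h0 : ∀ i : Fin k, d'.c (Fin.castLE hk i.castSucc) = 0)
    (h1 : d'.c (Fin.castLE hk (Fin.last k)) = -1) : ¬ DFeasible K d := by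
  rintro ⟨y, hy, hyc⟩
  have hrow : ∀ i, ⟪d'.a i, y⟫ = d'.c i := fun i => congrFun (hd'.astar_eq hyc) i
  have := inner_last_nonneg hFR hy fun i => (hrow _).trans (h0 i)
  rw [hrow, h1] at this
  norm_num at this

theorem exists_of_not_dStronglyInfeasible (h : ¬ DStronglyInfeasible K d) :
    ∃ (l : ℕ) (y : Fin (l + 1) → Y), l ≤ maxFaceChain (K : Set Y) - 1 ∧
      IsPreStrict (K : Set Y) y ∧ (∀ i : Fin l, d.Astar (y i.castSucc) = 0) ∧
      d.Astar (y (Fin.last l)) = d.c := by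
  rcases exists_inner_eq_or_exists_sum_eq_zero d.a d.c with ⟨z, hz⟩ | ⟨x, hx, hc⟩
  · have hz : d.Astar z = d.c := funext hz
    obtain ⟨l, y, hl, hy, hy0, hy1⟩ := exists_isPreStrict K
      (Submodule.span ℝ (Set.range d.a)) (z := z) (by
        rintro x ⟨hxK, hx⟩
        obtain ⟨x, rfl⟩ := Data.mem_span_iff.1 hx
        change 0 ≤ ⟪d.A x, z⟫
        rw [d.inner_A, hz]
        by_contra! hneg
        refine h ⟨(-∑ i, d.c i * x i)⁻¹ • x, ?_, ?_⟩
        · rw [d.A_eq_linearCombination, map_smul]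
          exact K.smul_mem hxK (inv_nonneg.2 (neg_nonneg.2 hneg.le))
        · simp only [Pi.smul_apply, smul_eq_mul, mul_left_comm (d.c _)]
          rw [← Finset.mul_sum, inv_neg, neg_mul, inv_mul_cancel₀ hneg.ne])
    refine ⟨l, y, hl, hy, fun i => Data.mem_orthogonal_iff.1 (hy0 i), ?_⟩
    rw [← hz]
    funext i
    have := congrFun (Data.mem_orthogonal_iff.1 hy1) i
    simp only [Data.Astar, inner_sub_right, Pi.zero_apply] at this ⊢
    linarith
  -- Inconsistent equations already give strong infeasibility, since `A x = 0` lies in `K`.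
  · refine absurd ⟨x, ?_, hc⟩ h
    have : d.A x = 0 := hx
    rw [this]
    exact zero_mem K

theorem not_dStronglyInfeasible_of_exists {l : ℕ} {y : Fin (l + 1) → Y}
    (hFR : y ∈ FR (K : Set Y) (l + 1)) (h0 : ∀ i : Fin l, d.Astar (y i.castSucc) = 0)
    (h1 : d.Astar (y (Fin.last l)) = d.c) : ¬ DStronglyInfeasible K d := by
  rintro ⟨x, hx, hc⟩
  have := inner_last_nonneg hFR hx fun i => by
    rw [real_inner_comm, d.inner_A, h0]
    simp
  rw [real_inner_comm, d.inner_A, h1, hc] at this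
  norm_num at this

theorem exists_of_not_pFeasible (h : ¬ PFeasible K d) :
    ∃ (k : ℕ) (y : Fin (k + 1) → Y), k ≤ maxFaceChain (K : Set Y) - 1 ∧
      IsPreStrict (K : Set Y) y ∧
      (∀ i : Fin k, d.Astar (y i.castSucc) = 0 ∧ ⟪d.b, y i.castSucc⟫ = 0) ∧
      d.Astar (y (Fin.last k)) = 0 ∧ ⟪d.b, y (Fin.last k)⟫ = -1 := by
  obtain ⟨k, y, hk, hy, hy0, hy1, hyb⟩ := exists_isPreStrict_of_disjoint K
    (Submodule.span ℝ (Set.range d.a)) d.b (fun x hx hmem => by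
      obtain ⟨x, rfl⟩ := Data.mem_span_iff.1 hx
      refine h ⟨-x, ?_⟩
      rw [d.A_eq_linearCombination, map_neg, sub_neg_eq_add]
      exact hmem)
  exact ⟨k, y, hk, hy, fun i => ⟨Data.mem_orthogonal_iff.1 (hy0 i).1, (hy0 i).2⟩,
    Data.mem_orthogonal_iff.1 hy1, hyb⟩

theorem not_pFeasible_of_exists {k : ℕ} {y : Fin (k + 1) → Y}
    (hFR : y ∈ FR (K : Set Y) (k + 1))
    (h0 : ∀ i : Fin k, d.Astar (y i.castSucc) = 0 ∧ ⟪d.b, y i.castSucc⟫ = 0)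
    (h1 : d.Astar (y (Fin.last k)) = 0) (hb : ⟪d.b, y (Fin.last k)⟫ = -1) :
    ¬ PFeasible K d := by
  rintro ⟨x, hx⟩
  have := inner_last_nonneg hFR hx fun i => by
    rw [real_inner_comm, inner_sub_left, d.inner_A, (h0 i).1, (h0 i).2]
    simp
  rw [real_inner_comm, inner_sub_left, d.inner_A, h1, hb] at this
  norm_num at this

/-- The hypothesis says that `b` is nonnegative on the dual cone intersected with the kernel of
`A^*`. The last term is reached by shifting `b`, so only the first `l` terms occupy rows. -/
theorem exists_of_not_pStronglyInfeasible (h : ¬ PStronglyInfeasible K d) :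
    ∃ d' : Data m Y, IsReformulation d d' ∧ ∃ (l : ℕ) (hl : l ≤ m),
      l ≤ maxFaceChain (ProperCone.innerDual (K : Set Y) : Set Y) - 1 ∧
      IsPreStrict (ProperCone.innerDual (K : Set Y) : Set Y)
        (Fin.snoc (fun i : Fin l => d'.a (Fin.castLE hl i)) d'.b : Fin (l + 1) → Y) := by
  obtain ⟨k, y, hk, hy, hy0, hy1⟩ := exists_isPreStrict (ProperCone.innerDual (K : Set Y))
    (Submodule.span ℝ (Set.range d.a))ᗮ (z := d.b) (by
      rintro y ⟨hyK, hy⟩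
      have hy0 := Data.mem_orthogonal_iff.1 hy
      change 0 ≤ ⟪y, d.b⟫
      rw [real_inner_comm]
      by_contra! hneg
      refine h ⟨(-⟪d.b, y⟫)⁻¹ • y,
        ProperCone.smul_mem _ hyK (inv_nonneg.2 (neg_nonneg.2 hneg.le)),
        Data.mem_orthogonal_iff.1 (Submodule.smul_mem _ _ hy), ?_⟩
      rw [real_inner_smul_right, inv_neg, neg_mul, inv_mul_cancel₀ hneg.ne])
  rw [Submodule.orthogonal_orthogonal] at hy0 hy1
  choose l hl using fun i => Data.mem_span_iff.1 (hy0 i)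
  obtain ⟨μ, hμ⟩ := Data.mem_span_iff.1 hy1
  have hl' : Fin.init y = fun i => d.A (l i) := funext fun i => (hl i).symm
  have hind : LinearIndependent ℝ l := by
    have := hy.2.linearIndependent
    rw [hl'] at this
    exact this.of_comp (Fintype.linearCombination ℝ d.a)
  obtain ⟨hkm, d', hd', hb, hrow⟩ := exists_isReformulation ⟨d.a, d.b + d.A (-μ), d.c⟩ l hind
  refine ⟨d', Relation.ReflTransGen.head (RowOp.shift d (-μ)) hd', k, hkm, hk, ?_⟩
  have hlast : d'.b = y (Fin.last k) := by
    rw [hb, d.A_eq_linearCombination, map_neg, ← d.A_eq_linearCombination, hμ,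
      neg_sub, add_sub_cancel]
  have hinit : (fun i => d'.a (Fin.castLE hkm i)) = Fin.init y := by
    rw [hl']
    exact funext fun i => (hrow i).1
  rw [hlast, hinit, Fin.snoc_init_self]
  exact hy

theorem not_pStronglyInfeasible_of_exists {d' : Data m Y} (hd' : IsReformulation d d') {l : ℕ}
    (hl : l ≤ m)
    (hFR : (Fin.snoc (fun i : Fin l => d'.a (Fin.castLE hl i)) d'.b : Fin (l + 1) → Y) ∈
      FR (ProperCone.innerDual (K : Set Y) : Set Y) (l + 1)) : ¬ PStronglyInfeasible K d := by
  rintro ⟨y, hy, hy0, hyb⟩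
  obtain ⟨h0, hb⟩ := hd'.astar_eq_zero hy0
  have := inner_last_nonneg hFR hy fun i => by
    rw [Fin.snoc_castSucc]
    exact congrFun h0 _
  rw [Fin.snoc_last, hb, hyb] at this
  norm_num at this

end Infeasibility

end ConicLP

theorem theorem3 {Y : Type*} [NormedAddCommGroup Y] [InnerProductSpace ℝ Y]
    [FiniteDimensional ℝ Y] (K : ProperCone ℝ Y) {m : ℕ} (d : ConicLP.Data m Y) :
    -- (1) infeasibility of (D)
    ((¬ ConicLP.DFeasible K d ↔
        ∃ d' : ConicLP.Data m Y, ConicLP.IsReformulation d d' ∧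
          ∃ (k : ℕ) (hk : k + 1 ≤ m),
            k ≤ ConicLP.maxFaceChain (ProperCone.innerDual (K : Set Y) : Set Y) - 1 ∧
            (fun i => d'.a (Fin.castLE hk i)) ∈
              ConicLP.FR (ProperCone.innerDual (K : Set Y) : Set Y) (k + 1) ∧
            (∀ i : Fin k, d'.c (Fin.castLE hk i.castSucc) = 0) ∧
            d'.c (Fin.castLE hk (Fin.last k)) = -1) ∧
      (¬ ConicLP.DFeasible K d →
        ∃ d' : ConicLP.Data m Y, ConicLP.IsReformulation d d' ∧
          ∃ (k : ℕ) (hk : k + 1 ≤ m),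
            k ≤ ConicLP.maxFaceChain (ProperCone.innerDual (K : Set Y) : Set Y) - 1 ∧
            ConicLP.IsPreStrict (ProperCone.innerDual (K : Set Y) : Set Y)
              (fun i : Fin (k + 1) => d'.a (Fin.castLE hk i)) ∧
            (∀ i : Fin k, d'.c (Fin.castLE hk i.castSucc) = 0) ∧
            d'.c (Fin.castLE hk (Fin.last k)) = -1)) ∧
    -- (2) absence of strong infeasibility of (D)
    ((¬ ConicLP.DStronglyInfeasible K d ↔
        ∃ (l : ℕ) (y : Fin (l + 1) → Y),
          l ≤ ConicLP.maxFaceChain (K : Set Y) - 1 ∧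
          y ∈ ConicLP.FR (K : Set Y) (l + 1) ∧
          (∀ i : Fin l, d.Astar (y i.castSucc) = 0) ∧
          d.Astar (y (Fin.last l)) = d.c) ∧
      (¬ ConicLP.DStronglyInfeasible K d →
        ∃ (l : ℕ) (y : Fin (l + 1) → Y),
          l ≤ ConicLP.maxFaceChain (K : Set Y) - 1 ∧
          ConicLP.IsPreStrict (K : Set Y) y ∧
          (∀ i : Fin l, d.Astar (y i.castSucc) = 0) ∧
          d.Astar (y (Fin.last l)) = d.c)) ∧
    -- (3) infeasibility of (P)
    ((¬ ConicLP.PFeasible K d ↔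
        ∃ (k : ℕ) (y : Fin (k + 1) → Y),
          k ≤ ConicLP.maxFaceChain (K : Set Y) - 1 ∧
          y ∈ ConicLP.FR (K : Set Y) (k + 1) ∧
          (∀ i : Fin k, d.Astar (y i.castSucc) = 0 ∧ inner ℝ d.b (y i.castSucc) = 0) ∧
          d.Astar (y (Fin.last k)) = 0 ∧ inner ℝ d.b (y (Fin.last k)) = -1) ∧
      (¬ ConicLP.PFeasible K d →
        ∃ (k : ℕ) (y : Fin (k + 1) → Y),
          k ≤ ConicLP.maxFaceChain (K : Set Y) - 1 ∧
          ConicLP.IsPreStrict (K : Set Y) y ∧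
          (∀ i : Fin k, d.Astar (y i.castSucc) = 0 ∧ inner ℝ d.b (y i.castSucc) = 0) ∧
          d.Astar (y (Fin.last k)) = 0 ∧ inner ℝ d.b (y (Fin.last k)) = -1)) ∧
    -- (4) absence of strong infeasibility of (P)
    ((¬ ConicLP.PStronglyInfeasible K d ↔
        ∃ d' : ConicLP.Data m Y, ConicLP.IsReformulation d d' ∧
          ∃ (l : ℕ) (hl : l ≤ m),
            l ≤ ConicLP.maxFaceChain (ProperCone.innerDual (K : Set Y) : Set Y) - 1 ∧
            (Fin.snoc (fun i : Fin l => d'.a (Fin.castLE hl i)) d'.b : Fin (l + 1) → Y) ∈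
              ConicLP.FR (ProperCone.innerDual (K : Set Y) : Set Y) (l + 1)) ∧
      (¬ ConicLP.PStronglyInfeasible K d →
        ∃ d' : ConicLP.Data m Y, ConicLP.IsReformulation d d' ∧
          ∃ (l : ℕ) (hl : l ≤ m),
            l ≤ ConicLP.maxFaceChain (ProperCone.innerDual (K : Set Y) : Set Y) - 1 ∧
            ConicLP.IsPreStrict (ProperCone.innerDual (K : Set Y) : Set Y)
              (Fin.snoc (fun i : Fin l => d'.a (Fin.castLE hl i)) d'.b : Fin (l + 1) → Y))) := by
  refine ⟨⟨⟨fun h => ?_, ?_⟩, ConicLP.exists_of_not_dFeasible⟩,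
    ⟨⟨fun h => ?_, ?_⟩, ConicLP.exists_of_not_dStronglyInfeasible⟩,
    ⟨⟨fun h => ?_, ?_⟩, ConicLP.exists_of_not_pFeasible⟩,
    ⟨⟨fun h => ?_, ?_⟩, ConicLP.exists_of_not_pStronglyInfeasible⟩⟩
  · obtain ⟨d', hd', k, hk, hle, hpre, h0⟩ := ConicLP.exists_of_not_dFeasible h
    exact ⟨d', hd', k, hk, hle, hpre.1, h0⟩
  · rintro ⟨d', hd', k, hk, -, hFR, h0, h1⟩
    exact ConicLP.not_dFeasible_of_exists hd' hk hFR h0 h1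
  · obtain ⟨l, y, hle, hpre, h0⟩ := ConicLP.exists_of_not_dStronglyInfeasible h
    exact ⟨l, y, hle, hpre.1, h0⟩
  · rintro ⟨l, y, -, hFR, h0, h1⟩
    exact ConicLP.not_dStronglyInfeasible_of_exists hFR h0 h1
  · obtain ⟨k, y, hle, hpre, h0⟩ := ConicLP.exists_of_not_pFeasible h
    exact ⟨k, y, hle, hpre.1, h0⟩
  · rintro ⟨k, y, -, hFR, h0, h1, hb⟩
    exact ConicLP.not_pFeasible_of_exists hFR h0 h1 hb
  · obtain ⟨d', hd', l, hl, hle, hpre⟩ := ConicLP.exists_of_not_pStronglyInfeasible h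
    exact ⟨d', hd', l, hl, hle, hpre.1⟩
  · rintro ⟨d', hd', l, hl, -, hFR⟩
    exact ConicLP.not_pStronglyInfeasible_of_exists hd' hl hFR
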